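/- For a finite simple graph $G$ on $n$ vertices whose adjacency matrix has eigenvalues $\lambda_1,\dots,\lambda_n$ (with multiplicity), let $ER(G)=\sum_{i=1}^n \frac{1}{n-\lambda_i}$ denote its resolvent energy. A unicyclic graph is a connected graph with equally many vertices and edges (equivalently, a connected graph with exactly one cycle). Let $C_n$ be the cycle on $n$ vertices, and let $C_n^*$ be the graph on $n$ vertices obtained by attaching one pendent vertex to a vertex of $C_{n-1}$. Let $G$ be a unicyclic graph on $n \ge 5$ vertices. If $G \not\cong C_n$ and $G \not\cong C_n^*$, then $$ER(G) > \min\{ER(C_n),\, ER(C_n^*)\}.$$ -/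

import Mathlib

namespace SimpleGraph

/-- The resolvent energy `∑ᵢ 1 / (n - λᵢ)` of a graph on `n` vertices, where the `λᵢ` are the
eigenvalues (with multiplicity) of its adjacency matrix over `ℝ`. -/
noncomputable def resolventEnergy {V : Type*} [Fintype V] [DecidableEq V]
    (G : SimpleGraph V) [DecidableRel G.Adj] : ℝ :=
  ∑ i : V, 1 / ((Fintype.card V : ℝ) - (G.isHermitian_adjMatrix ℝ).eigenvalues i)

/-- A unicyclic graph: connected, with as many edges as vertices
(that is, of cyclomatic number `1`). -/
def IsUnicyclic {V : Type*} [Fintype V] (G : SimpleGraph V) [DecidableRel G.Adj] : Prop :=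
  G.Connected ∧ G.edgeFinset.card = Fintype.card V

/-- The adjacency relation of `G` with a new vertex `none` attached to `v`. -/
def AttachPendantAdj {V : Type*} (G : SimpleGraph V) (v : V) : Option V → Option V → Prop
  | some a, some b => G.Adj a b
  | some a, none => a = v
  | none, some b => b = v
  | none, none => False

/-- The graph obtained from `G` by attaching a pendent vertex `none` to the vertex `v`. -/
def attachPendant {V : Type*} (G : SimpleGraph V) (v : V) : SimpleGraph (Option V) where
  Adj := G.AttachPendantAdj v
  symm := ⟨fun x y h => match x, y, h with
    | some _, some _, h => G.adj_symm h
    | some _, none, h => h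
    | none, some _, h => h⟩
  loopless := ⟨fun x h => match x, h with
    | some _, h => G.irrefl h⟩

instance attachPendant.decidableRelAdj {V : Type*} [DecidableEq V] (G : SimpleGraph V)
    [DecidableRel G.Adj] (v : V) : DecidableRel (G.attachPendant v).Adj
  | some a, some b => inferInstanceAs (Decidable (G.Adj a b))
  | some a, none => inferInstanceAs (Decidable (a = v))
  | none, some b => inferInstanceAs (Decidable (b = v))
  | none, none => inferInstanceAs (Decidable False)

/-- The graph `C_n^*` on `n` vertices: the cycle `C_{n-1}` with one pendent vertex attached. -/
abbrev cycleStar (n : ℕ) (hn : 2 ≤ n) : SimpleGraph (Option (Fin (n - 1))) :=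
  (cycleGraph (n - 1)).attachPendant ⟨0, by omega⟩

end SimpleGraph

open Finset

/-! In fact `C_n` alone has smaller energy than `G`. Power sums of eigenvalues are traces, i.e.
counts of closed walks. Both graphs have moments `n, 0, 2n` in degrees 0, 1, 2. Since `G` is
connected but not a cycle, it is not 2-regular; its degree variance then adds at least 4 to the
fourth moment `6n` of `C_n`. Polynomial bounds on `1 / (n - x)`, above for `C_n` (`one_div_sub_le`)
and below for `G` (`le_one_div_sub`), turn this into rational functions of `n`, compared in
`cycle_bound_lt`. To leading order, the gain is `4 / n ^ 5` and the quartic majorant costs only `2 /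
n ^ 5`. -/

theorem Matrix.IsHermitian.trace_pow_eq_sum_eigenvalues_pow {ι : Type*} [Fintype ι] [DecidableEq ι]
    {A : Matrix ι ι ℝ} (hA : A.IsHermitian) (k : ℕ) :
    (A ^ k).trace = ∑ i, hA.eigenvalues i ^ k := by
  conv_lhs => rw [hA.spectral_theorem]
  rw [← map_pow, Matrix.diagonal_pow, Unitary.conjStarAlgAut_apply, Matrix.trace_mul_comm,
    ← mul_assoc]
  simp [Matrix.trace_diagonal]

namespace SimpleGraph

/-! ### Spectral moments and degrees -/

theorem adjMatrix_mul_self_apply {V : Type*} [Fintype V] (G : SimpleGraph V)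
    [DecidableRel G.Adj] (u v : V) :
    (G.adjMatrix ℝ * G.adjMatrix ℝ) u v = #{w | G.Adj u w ∧ G.Adj w v} := by
  simp [Matrix.mul_apply, adjMatrix_apply, ← ite_and, and_comm]

theorem sum_adjMatrix_mul_self {V : Type*} [Fintype V] (G : SimpleGraph V)
    [DecidableRel G.Adj] :
    ∑ u, ∑ v, (G.adjMatrix ℝ * G.adjMatrix ℝ) u v = ∑ v, (G.degree v : ℝ) ^ 2 := by
  have h : ∀ v, ∑ u, G.adjMatrix ℝ v u = G.degree v := fun v => by
    simp [adjMatrix_apply, neighborFinset_eq_filter, ← card_neighborFinset_eq_degree]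
  have h' : ∀ v, ∑ u, G.adjMatrix ℝ u v = G.degree v := fun v => by
    rw [← h]; simp [adjMatrix_apply, adj_comm]
  simp only [Matrix.mul_apply]
  calc _ = ∑ u, ∑ w, ∑ v, G.adjMatrix ℝ u w * G.adjMatrix ℝ w v :=
        sum_congr rfl fun u _ => sum_comm
    _ = ∑ w, ∑ u, ∑ v, G.adjMatrix ℝ u w * G.adjMatrix ℝ w v := sum_comm
    _ = _ := by
      refine sum_congr rfl fun w _ => ?_
      rw [← sum_mul_sum, h, h', pow_two]

variable {V : Type*} [Fintype V] [DecidableEq V] (G : SimpleGraph V) [DecidableRel G.Adj]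

theorem abs_eigenvalues_adjMatrix_le {d : ℕ} (hd : ∀ v, G.degree v ≤ d) (i : V) :
    |(G.isHermitian_adjMatrix ℝ).eigenvalues i| ≤ d := by
  have hmem := (G.isHermitian_adjMatrix ℝ).eigenvalues_mem_spectrum_real i
  rw [← Matrix.spectrum_toLin', ← Module.End.hasEigenvalue_iff_mem_spectrum] at hmem
  -- Gershgorin: the discs are centred at the zero diagonal entries, with radii at most the degrees.
  obtain ⟨k, hk⟩ := eigenvalue_mem_ball hmem
  have hsum : ∑ j ∈ univ.erase k, ‖G.adjMatrix ℝ k j‖ ≤ (G.degree k : ℝ) := by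
    refine (sum_le_sum_of_subset_of_nonneg (erase_subset _ _) fun _ _ _ => norm_nonneg _).trans ?_
    rw [← G.adjMatrix_mulVec_const_apply (a := (1 : ℝ)) |>.trans (mul_one _)]
    simp [adjMatrix_apply, apply_ite, Matrix.mulVec, dotProduct]
  rw [Metric.mem_closedBall, Real.dist_eq] at hk
  simp only [adjMatrix_apply, G.irrefl, if_false, sub_zero] at hk
  exact hk.trans (hsum.trans (by exact_mod_cast hd k))

theorem trace_adjMatrix_pow_nonneg (k : ℕ) : 0 ≤ (G.adjMatrix ℝ ^ k).trace := by
  refine sum_nonneg fun v _ => ?_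
  rw [Matrix.diag_apply, adjMatrix_pow_apply_eq_card_walk]
  positivity

theorem trace_adjMatrix_sq : (G.adjMatrix ℝ ^ 2).trace = ∑ v, (G.degree v : ℝ) := by
  simp only [pow_two, Matrix.trace, Matrix.diag_apply, adjMatrix_mul_self_apply_self]

theorem trace_adjMatrix_pow_four :
    (G.adjMatrix ℝ ^ 4).trace = ∑ u, ∑ v, (G.adjMatrix ℝ * G.adjMatrix ℝ) u v ^ 2 := by
  have h : G.adjMatrix ℝ ^ 4 =
      (G.adjMatrix ℝ * G.adjMatrix ℝ) * (G.adjMatrix ℝ * G.adjMatrix ℝ) := by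
    noncomm_ring
  have hs : ∀ u v, (G.adjMatrix ℝ * G.adjMatrix ℝ) v u = (G.adjMatrix ℝ * G.adjMatrix ℝ) u v := by
    intro u v
    rw [← Matrix.transpose_apply (G.adjMatrix ℝ * G.adjMatrix ℝ), Matrix.transpose_mul,
      transpose_adjMatrix]
  rw [h, Matrix.trace]
  refine sum_congr rfl fun u _ => ?_
  rw [Matrix.diag_apply, Matrix.mul_apply]
  exact sum_congr rfl fun v _ => by rw [hs u v, pow_two]

/-- Closed walks of length four, apart from the four-cycles, are counted by the degrees;
the last double sum counts the four-cycles. -/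
theorem trace_adjMatrix_pow_four_eq :
    (G.adjMatrix ℝ ^ 4).trace = 2 * ∑ v, (G.degree v : ℝ) ^ 2 - ∑ v, (G.degree v : ℝ) +
      ∑ u, ∑ v ∈ univ.erase u, ((G.adjMatrix ℝ * G.adjMatrix ℝ) u v ^ 2 -
        (G.adjMatrix ℝ * G.adjMatrix ℝ) u v) := by
  have h : ∀ u, ∑ v ∈ univ.erase u, ((G.adjMatrix ℝ * G.adjMatrix ℝ) u v ^ 2 -
        (G.adjMatrix ℝ * G.adjMatrix ℝ) u v) = ∑ v, (G.adjMatrix ℝ * G.adjMatrix ℝ) u v ^ 2 -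
        ∑ v, (G.adjMatrix ℝ * G.adjMatrix ℝ) u v - ((G.degree u : ℝ) ^ 2 - G.degree u) := by
    intro u
    rw [sum_erase_eq_sub (mem_univ u), adjMatrix_mul_self_apply_self, sum_sub_distrib]
  simp only [h, sum_sub_distrib]
  rw [sum_adjMatrix_mul_self, trace_adjMatrix_pow_four]
  ring

theorem le_trace_adjMatrix_pow_four :
    2 * ∑ v, (G.degree v : ℝ) ^ 2 - ∑ v, (G.degree v : ℝ) ≤ (G.adjMatrix ℝ ^ 4).trace := by
  rw [trace_adjMatrix_pow_four_eq, le_add_iff_nonneg_right]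
  refine sum_nonneg fun u _ => sum_nonneg fun v _ => ?_
  rw [adjMatrix_mul_self_apply, sub_nonneg]
  exact_mod_cast Nat.le_self_pow two_ne_zero _

/-- A graph with as many edges as vertices and a vertex of degree other than two has at least
`4` more closed walks of length four than a long cycle on the same number of vertices. -/
theorem six_mul_card_add_four_le_trace_adjMatrix_pow_four
    (hE : #G.edgeFinset = Fintype.card V) {a : V} (ha : G.degree a ≠ 2) :
    6 * (Fintype.card V : ℝ) + 4 ≤ (G.adjMatrix ℝ ^ 4).trace := by
  have hd : ∑ v, (G.degree v : ℤ) = 2 * Fintype.card V := by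
    rw [← hE]; exact_mod_cast G.sum_degrees_eq_twice_card_edges
  have hz : ∑ v, ((G.degree v : ℤ) - 2) = 0 := by
    rw [sum_sub_distrib, hd]; simp [mul_comm]
  -- The deviations `d - 2` sum to zero, so a nonzero one forces another.
  obtain ⟨b, hba, hb⟩ : ∃ b ≠ a, (G.degree b : ℤ) - 2 ≠ 0 := by
    by_contra! hcon
    rw [sum_eq_single a (fun b _ hb => hcon b hb) (by simp)] at hz
    omega
  have hsq : ∀ x : ℤ, x ≠ 0 → 1 ≤ x ^ 2 := fun x hx => by
    have := sq_pos_of_ne_zero hx; omega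
  have htwo : 2 ≤ ∑ v, ((G.degree v : ℤ) - 2) ^ 2 := by
    calc (2 : ℤ) ≤ ∑ v ∈ {a, b}, ((G.degree v : ℤ) - 2) ^ 2 := by
          rw [sum_pair hba.symm]
          have := hsq _ hb
          have := hsq ((G.degree a : ℤ) - 2) (by omega)
          omega
      _ ≤ _ := sum_le_sum_of_subset_of_nonneg (subset_univ _) fun _ _ _ => sq_nonneg _
  have hexp : ∑ v, ((G.degree v : ℤ) - 2) ^ 2 =
      ∑ v, (G.degree v : ℤ) ^ 2 - 4 * Fintype.card V := by
    simp only [sub_sq, sum_add_distrib, sum_sub_distrib, ← sum_mul, ← mul_sum, hd]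
    simp; ring
  have hsum : (4 * (Fintype.card V : ℝ) + 2) ≤ ∑ v, (G.degree v : ℝ) ^ 2 := by
    have : 4 * (Fintype.card V : ℤ) + 2 ≤ ∑ v, (G.degree v : ℤ) ^ 2 := by omega
    exact_mod_cast this
  have hd' : ∑ v, (G.degree v : ℝ) = 2 * Fintype.card V := by exact_mod_cast hd
  have := G.le_trace_adjMatrix_pow_four
  linarith

/-- If no two distinct vertices have two common neighbours, then there is no four-cycle. -/
theorem trace_adjMatrix_pow_four_of_card_le_one
    (h : ∀ u v, u ≠ v → #{w | G.Adj u w ∧ G.Adj w v} ≤ 1) :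
    (G.adjMatrix ℝ ^ 4).trace = 2 * ∑ v, (G.degree v : ℝ) ^ 2 - ∑ v, (G.degree v : ℝ) := by
  rw [trace_adjMatrix_pow_four_eq, add_eq_left]
  refine sum_eq_zero fun u _ => sum_eq_zero fun v hv => ?_
  rw [adjMatrix_mul_self_apply]
  have := h u v (ne_of_mem_erase hv).symm
  interval_cases #{w | G.Adj u w ∧ G.Adj w v} <;> simp

theorem trace_adjMatrix_pow_three_of_triangle_free
    (h : ∀ u v w, G.Adj u v → G.Adj v w → ¬ G.Adj w u) :
    (G.adjMatrix ℝ ^ 3).trace = 0 := by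
  rw [pow_succ, pow_two, Matrix.trace]
  refine sum_eq_zero fun u _ => ?_
  rw [Matrix.diag_apply, Matrix.mul_apply]
  refine sum_eq_zero fun v _ => ?_
  rw [adjMatrix_mul_self_apply, adjMatrix_apply]
  split_ifs with hvu
  · rw [mul_one, Nat.cast_eq_zero, card_eq_zero, filter_eq_empty_iff]
    exact fun w _ hw => h u w v hw.1 hw.2 hvu
  · exact mul_zero _

end SimpleGraph

namespace SimpleGraph

/-! ### Structure of cycles -/

theorem cycleGraph_isRegularOfDegree_two {n : ℕ} (hn : 3 ≤ n) :
    (cycleGraph n).IsRegularOfDegree 2 := by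
  obtain ⟨m, rfl⟩ := Nat.exists_eq_add_of_le' hn
  exact fun v => cycleGraph_degree_three_le

/-- A connected `2`-regular graph is a cycle. -/
theorem Connected.nonempty_iso_cycleGraph {V : Type*} [Fintype V] [DecidableEq V]
    {G : SimpleGraph V} [DecidableRel G.Adj] (hG : G.Connected) (hd : G.IsRegularOfDegree 2) :
    Nonempty (G ≃g cycleGraph (Fintype.card V)) := by
  have hcyc : G.IsCycles := fun v _ => by
    rw [← Nat.card_coe_set_eq, Nat.card_eq_fintype_card, card_neighborSet_eq_degree, hd v]
  obtain ⟨v⟩ := hG.nonempty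
  have hne : (G.neighborSet v).Nonempty := by
    obtain ⟨w, hw⟩ := (G.degree_pos_iff_exists_adj v).1 (by rw [hd v]; norm_num)
    exact ⟨w, hw⟩
  obtain ⟨p, hp, hverts⟩ := hcyc.exists_cycle_toSubgraph_verts_eq_connectedComponentSupp
    (c := G.connectedComponentMk v) rfl hne
  have hmem : ∀ w, w ∈ p.support := fun w => by
    rw [← p.mem_verts_toSubgraph, hverts, ConnectedComponent.mem_supp_iff,
      ConnectedComponent.eq]
    exact hG w v
  have htail : p.support.tail.toFinset = univ := by
    ext w
    simp only [List.mem_toFinset, mem_univ, iff_true]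
    have hw := hmem w
    rw [← p.cons_tail_support, List.mem_cons] at hw
    rcases hw with rfl | hw
    · exact p.end_mem_tail_support hp.not_nil
    · exact hw
  have hlen : p.length = Fintype.card V := by
    rw [← card_univ, ← htail, List.toFinset_card_of_nodup hp.support_nodup]
    simp
  have hn : 2 < Fintype.card V := hlen ▸ hp.three_le_length
  obtain ⟨f⟩ := (cycleGraph_isContained_iff hn).2 ⟨v, p, hp, hlen⟩
  have hbij : Function.Bijective f :=
    (Fintype.bijective_iff_injective_and_card f).2 ⟨f.injective, by simp⟩
  refine ⟨RelIso.symm ⟨Equiv.ofBijective f hbij,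
    fun {x y} => ⟨fun h => ?_, fun h => f.toHom.map_adj h⟩⟩⟩
  -- Both sides have two elements, so the bijective copy also reflects adjacency.
  have himg : ((cycleGraph (Fintype.card V)).neighborFinset x).image f = G.neighborFinset (f x) := by
    refine eq_of_subset_of_card_le ?_ ?_
    · intro z hz
      obtain ⟨t, ht, rfl⟩ := mem_image.1 hz
      rw [mem_neighborFinset] at ht ⊢
      exact f.toHom.map_adj ht
    · rw [card_image_of_injective _ hbij.injective, card_neighborFinset_eq_degree,
        card_neighborFinset_eq_degree, hd, cycleGraph_isRegularOfDegree_two hn]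
  have hy : f y ∈ G.neighborFinset (f x) := by rwa [mem_neighborFinset]
  rw [← himg, mem_image] at hy
  obtain ⟨t, ht, hty⟩ := hy
  rw [f.injective hty, mem_neighborFinset] at ht
  exact ht

theorem cycleGraph_adj_iff_val {n : ℕ} (hn : 3 ≤ n) (u v : Fin n) :
    (cycleGraph n).Adj u v ↔ u.val + 1 = v.val ∨ v.val + 1 = u.val ∨
      (u.val + 1 = n ∧ v.val = 0) ∨ (v.val + 1 = n ∧ u.val = 0) := by
  rw [cycleGraph_adj']
  rcases lt_or_ge u v with h | h
  · rw [Fin.coe_sub_iff_lt.2 h, Fin.sub_val_of_le h.le]; omega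
  · rcases h.eq_or_lt with h | h
    · subst h; rw [Fin.sub_val_of_le le_rfl]; omega
    · rw [Fin.coe_sub_iff_lt.2 h, Fin.sub_val_of_le h.le]; omega

theorem cycleGraph_triangle_free {n : ℕ} (hn : 4 ≤ n) (u v w : Fin n)
    (huv : (cycleGraph n).Adj u v) (hvw : (cycleGraph n).Adj v w) : ¬ (cycleGraph n).Adj w u := by
  rw [cycleGraph_adj_iff_val (by omega)] at *
  omega

theorem card_common_neighbors_cycleGraph_le_one {n : ℕ} (hn : 5 ≤ n) (u v : Fin n) (huv : u ≠ v) :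
    #{w | (cycleGraph n).Adj u w ∧ (cycleGraph n).Adj w v} ≤ 1 := by
  refine card_le_one.2 fun a ha b hb => ?_
  simp only [mem_filter, mem_univ, true_and, cycleGraph_adj_iff_val (by omega : 3 ≤ n)] at ha hb
  rw [Fin.ext_iff] at *
  omega


/-! ### Energy bounds -/

/-- The bound comes from `(x - 2) * (x ^ 2 + x - 1) ^ 2 = x ^ 5 - 5 * x ^ 3 + 5 * x - 2` being
nonpositive for `x ≤ 2`. -/
theorem one_div_sub_le {a x : ℝ} (ha : 2 < a) (hx : x ≤ 2) :
    1 / (a - x) ≤ (x ^ 4 + a * x ^ 3 + (a ^ 2 - 5) * x ^ 2 + (a ^ 3 - 5 * a) * x +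
      (a ^ 4 - 5 * a ^ 2 + 5)) / (a ^ 5 - 5 * a ^ 3 + 5 * a - 2) := by
  have hQ : 0 < a ^ 5 - 5 * a ^ 3 + 5 * a - 2 := by
    -- The quintic is the characteristic polynomial of `C_5`; with `Q` for it, the numerator is `(Q
    -- a - Q x) / (a - x)`.
    have h : a ^ 5 - 5 * a ^ 3 + 5 * a - 2 = (a - 2) * (a ^ 2 + a - 1) ^ 2 := by ring
    rw [h]
    have : 0 < a ^ 2 + a - 1 := by nlinarith
    have : 0 < a - 2 := by linarith
    positivity
  rw [div_le_div_iff₀ (by linarith) hQ]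
  nlinarith [mul_nonneg (sub_nonneg.2 hx) (sq_nonneg (x ^ 2 + x - 1))]

/-- Truncation of the geometric series, with the sixth power replaced by
`6 * x ^ 4 - 9 * x ^ 2`. -/
theorem le_one_div_sub {a x : ℝ} (ha : 0 < a) (hx : x < a) :
    (a ^ 7 + a ^ 6 * x + (a ^ 5 - 9 * a) * x ^ 2 + a ^ 4 * x ^ 3 + (a ^ 3 + 6 * a) * x ^ 4 +
      a ^ 2 * x ^ 5 + x ^ 7) / a ^ 8 ≤ 1 / (a - x) := by
  have hax : 0 < a - x := sub_pos.2 hx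
  rw [div_le_div_iff₀ (by positivity) hax]
  -- Tangency at `x ^ 2 = 3`, the ratio of the moments `6n` and `2n`, makes the replacement of `x ^
  -- 6` optimal to leading order.
  nlinarith [mul_nonneg (mul_nonneg ha.le hax.le) (sq_nonneg (x * (x ^ 2 - 3))),
    sq_nonneg (x ^ 4)]

theorem resolventEnergy_cycleGraph_le {n : ℕ} (hn : 5 ≤ n) :
    (cycleGraph n).resolventEnergy ≤
      n * ((n : ℝ) ^ 4 - 3 * n ^ 2 + 1) / ((n : ℝ) ^ 5 - 5 * n ^ 3 + 5 * n - 2) := by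
  set H := cycleGraph n
  have hreg : H.IsRegularOfDegree 2 := cycleGraph_isRegularOfDegree_two (by omega)
  have hn' : (5 : ℝ) ≤ n := by exact_mod_cast hn
  have hM := (H.isHermitian_adjMatrix ℝ).trace_pow_eq_sum_eigenvalues_pow
  have h1 := hM 1
  have h2 := hM 2
  have h3 := hM 3
  have h4 := hM 4
  rw [pow_one, trace_adjMatrix] at h1
  rw [trace_adjMatrix_sq] at h2
  rw [trace_adjMatrix_pow_three_of_triangle_free H (cycleGraph_triangle_free (by omega))] at h3
  rw [trace_adjMatrix_pow_four_of_card_le_one H (card_common_neighbors_cycleGraph_le_one hn)] at h4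
  simp only [hreg.degree_eq, sum_const, card_univ, Fintype.card_fin, nsmul_eq_mul,
    Nat.cast_ofNat, pow_one] at h1 h2 h4
  have hle : ∀ i, (H.isHermitian_adjMatrix ℝ).eigenvalues i ≤ 2 := fun i =>
    (le_abs_self _).trans (by exact_mod_cast H.abs_eigenvalues_adjMatrix_le (fun v => (hreg v).le) i)
  unfold resolventEnergy
  rw [Fintype.card_fin]
  refine (sum_le_sum fun i _ => one_div_sub_le (by linarith) (hle i)).trans (le_of_eq ?_)
  rw [← sum_div]
  simp only [sum_add_distrib, ← mul_sum, ← h1, ← h2, ← h3, ← h4, sum_const, card_univ,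
    Fintype.card_fin, nsmul_eq_mul]
  ring

/-- Odd closed-walk counts are nonnegative, so the odd powers from the third on can be dropped. -/
theorem le_resolventEnergy {V : Type*} [Fintype V] [DecidableEq V]
    (G : SimpleGraph V) [DecidableRel G.Adj] (hE : #G.edgeFinset = Fintype.card V)
    {a : V} (ha : G.degree a ≠ 2) :
    ((Fintype.card V : ℝ) ^ 7 + 2 * (Fintype.card V : ℝ) ^ 5 + 6 * (Fintype.card V : ℝ) ^ 3 +
      4 * (Fintype.card V : ℝ) ^ 2 + 18 * Fintype.card V + 24) / (Fintype.card V : ℝ) ^ 7 ≤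
      G.resolventEnergy := by
  have hpos : 0 < Fintype.card V := Fintype.card_pos_iff.2 ⟨a⟩
  have hM := (G.isHermitian_adjMatrix ℝ).trace_pow_eq_sum_eigenvalues_pow
  have h1 := hM 1
  have h2 := hM 2
  have h4 := G.six_mul_card_add_four_le_trace_adjMatrix_pow_four hE ha
  have h3 := G.trace_adjMatrix_pow_nonneg 3
  have h5 := G.trace_adjMatrix_pow_nonneg 5
  have h7 := G.trace_adjMatrix_pow_nonneg 7
  rw [hM] at h3 h4 h5 h7
  have hd : ∑ v, (G.degree v : ℝ) = 2 * Fintype.card V := by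
    rw [← hE]; exact_mod_cast G.sum_degrees_eq_twice_card_edges
  rw [pow_one, trace_adjMatrix] at h1
  rw [trace_adjMatrix_sq, hd] at h2
  simp only [pow_one] at h1
  have hlt : ∀ i, (G.isHermitian_adjMatrix ℝ).eigenvalues i < Fintype.card V := fun i => by
    refine (le_abs_self _).trans_lt ((G.abs_eigenvalues_adjMatrix_le
      (d := Fintype.card V - 1)
      (fun v => Nat.le_sub_one_of_lt (G.degree_lt_card_verts v)) i).trans_lt ?_)
    exact_mod_cast Nat.sub_lt hpos one_pos
  have hc : (0 : ℝ) < Fintype.card V := by exact_mod_cast hpos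
  unfold resolventEnergy
  refine le_trans ?_ (sum_le_sum fun i _ => le_one_div_sub hc (hlt i))
  rw [← sum_div]
  simp only [sum_add_distrib, ← mul_sum, ← h1, ← h2, sum_const, card_univ, nsmul_eq_mul]
  set c := (Fintype.card V : ℝ)
  rw [div_le_div_iff₀ (by positivity) (by positivity)]
  have e3 := mul_nonneg (pow_nonneg hc.le 4) h3
  have e5 := mul_nonneg (pow_nonneg hc.le 2) h5
  have e4 := mul_le_mul_of_nonneg_left h4 (by positivity : 0 ≤ c ^ 3 + 6 * c)
  calc _ = c ^ 7 * (c * (c ^ 7 + 2 * c ^ 5 + 6 * c ^ 3 + 4 * c ^ 2 + 18 * c + 24)) := by ring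
    _ ≤ c ^ 7 * _ := mul_le_mul_of_nonneg_left (by nlinarith) (by positivity)
    _ = _ := mul_comm _ _

theorem cycle_bound_lt {x : ℝ} (hx : 5 ≤ x) :
    x * (x ^ 4 - 3 * x ^ 2 + 1) / (x ^ 5 - 5 * x ^ 3 + 5 * x - 2) <
      (x ^ 7 + 2 * x ^ 5 + 6 * x ^ 3 + 4 * x ^ 2 + 18 * x + 24) / x ^ 7 := by
  -- After shifting by 5, all coefficients in `y` are nonnegative.
  obtain ⟨y, hy, rfl⟩ : ∃ y, 0 ≤ y ∧ x = y + 5 := ⟨x - 5, by linarith, by ring⟩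
  rw [div_lt_div_iff₀ (by ring_nf; positivity) (by positivity), ← sub_pos]
  ring_nf
  positivity

theorem resolventEnergy_cycleGraph_lt {V : Type*} [Fintype V] [DecidableEq V] (G : SimpleGraph V)
    [DecidableRel G.Adj] (hV : 5 ≤ Fintype.card V) (hG : G.IsUnicyclic)
    (hC : IsEmpty (G ≃g cycleGraph (Fintype.card V))) :
    (cycleGraph (Fintype.card V)).resolventEnergy < G.resolventEnergy := by
  obtain ⟨hconn, hE⟩ := hG
  obtain ⟨a, ha⟩ : ∃ a, G.degree a ≠ 2 := by
    by_contra! hreg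
    exact not_isEmpty_iff.2 (hconn.nonempty_iso_cycleGraph hreg) hC
  exact (resolventEnergy_cycleGraph_le hV).trans_lt
    ((cycle_bound_lt (by exact_mod_cast hV)).trans_le (G.le_resolventEnergy hE ha))

end SimpleGraph

theorem mainTheorem5 {V : Type*} [Fintype V] [DecidableEq V] (n : ℕ) (hn : 5 ≤ n)
    (G : SimpleGraph V) [DecidableRel G.Adj] (hV : Fintype.card V = n)
    (hG : G.IsUnicyclic)
    (hC : IsEmpty (G ≃g SimpleGraph.cycleGraph n))
    (hCs : IsEmpty (G ≃g SimpleGraph.cycleStar n (le_trans (by norm_num) hn))) :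
    min (SimpleGraph.cycleGraph n).resolventEnergy
        (SimpleGraph.cycleStar n (le_trans (by norm_num) hn)).resolventEnergy
      < G.resolventEnergy := by
  subst hV
  exact min_lt_of_left_lt (G.resolventEnergy_cycleGraph_lt hn hG hC)
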